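/- Let $X$ be a complex Banach space, let $T$ be a bounded linear operator on $X$, and let $\alpha>0$. For $\beta>0$ and $n\in\mathbb{N}_0=\{0,1,2,\dots\}$ put $$k^{\beta}(n)=\frac{\Gamma(\beta+n)}{\Gamma(\beta)\,\Gamma(n+1)},$$ and define the Cesàro mean of order $\alpha$ of $T$ by $$M_T^{\alpha}(n)=\frac{1}{k^{\alpha+1}(n)}\sum_{j=0}^{n}k^{\alpha}(n-j)\,T^{j},\qquad n\in\mathbb{N}_0.$$ Suppose that $T$ is $(C,\alpha)$-bounded, that is, $\sup_{n\in\mathbb{N}_0}\|M_T^{\alpha}(n)\|<\infty$, and that $\sigma(T)\cap\mathbb{T}\subseteq\{1\}$, where $\sigma(T)$ is the spectrum of $T$ and $\mathbb{T}=\{z\in\mathbb{C}:|z|=1\}$. Then $$\lim_{n\to\infty}\|M_T^{\alpha}(n+1)-M_T^{\alpha}(n)\|=0.$$ -/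

import Mathlib

noncomputable section

/-- The Cesàro kernel of order `α`: `k^α(n) = Γ(α + n) / (Γ(α) Γ(n + 1))`. It is used
only for `α > 0`, where the denominator does not vanish. -/
def cesaroKernel (α : ℝ) (n : ℕ) : ℝ :=
  Real.Gamma (α + n) / (Real.Gamma α * Real.Gamma (n + 1))

/-- The Cesàro sum of order `α` of `T`: `∑_{j=0}^n k^α(n-j) T^j`. -/
def cesaroSum {X : Type*} [NormedAddCommGroup X] [NormedSpace ℂ X]
    (α : ℝ) (T : X →L[ℂ] X) (n : ℕ) : X →L[ℂ] X :=
  ∑ j ∈ Finset.range (n + 1), ((cesaroKernel α (n - j) : ℝ) : ℂ) • T ^ j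

/-- The Cesàro mean of order `α` of `T`: the Cesàro sum divided by `k^(α+1)(n)`. -/
def cesaroMean {X : Type*} [NormedAddCommGroup X] [NormedSpace ℂ X]
    (α : ℝ) (T : X →L[ℂ] X) (n : ℕ) : X →L[ℂ] X :=
  ((1 / cesaroKernel (α + 1) n : ℝ) : ℂ) • cesaroSum α T n

/-- `T` is `(C,α)`-bounded: `sup_n ‖M_T^α(n)‖ < ∞`. -/
def IsCesaroBounded {X : Type*} [NormedAddCommGroup X] [NormedSpace ℂ X]
    (α : ℝ) (T : X →L[ℂ] X) : Prop :=
  BddAbove (Set.range fun n : ℕ => ‖cesaroMean α T n‖)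

end

/-! The means almost form an orbit: `T * M n - M (n + 1)` is `O(1 / n)` by
`mul_cesaroMean_sub_succ`. For a bounded asymptotic orbit, suppose the differences do not tend to
`0`. Testing translates of `M` against norming functionals of the differences, and passing to an
ultrafilter limit, yields bounded functionals `Λ m`, `m ∈ ℤ`, with `Λ m (B * T) = Λ (m + 1) B`
exactly. The Carleman transform of `m ↦ Λ m 1` is `Λ 0 (resolvent T z)`, hence continues across the
circle except at `1`. Its growth `O(1 / dist (z, 𝕋))` leaves at most a simple pole there, so it is
`c / (z - 1)` and `Λ 0 1 = Λ (-1) 1`; but these differ by the limit of the norms of the differences,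
a contradiction. -/

/-! ### Carleman transforms with a single singularity on the circle -/

lemma norm_tsum_mul_pow_le {b : ℕ → ℂ} {C : ℝ} (hb : ∀ n, ‖b n‖ ≤ C) {z : ℂ} (hz : ‖z‖ < 1) :
    ‖∑' n, b n * z ^ n‖ ≤ C * (1 - ‖z‖)⁻¹ := by
  refine tsum_of_norm_bounded ((hasSum_geometric_of_lt_one (norm_nonneg z) hz).mul_left C) fun n => ?_
  rw [norm_mul, norm_pow]
  gcongr
  exact hb n

lemma differentiableOn_tsum_mul_pow {b : ℕ → ℂ} {C : ℝ} (hb : ∀ n, ‖b n‖ ≤ C) :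
    DifferentiableOn ℂ (fun z => ∑' n, b n * z ^ n) (Metric.ball 0 1) := by
  intro z hz
  obtain ⟨r, hzr, hr⟩ := exists_between (mem_ball_zero_iff.1 hz)
  have hr0 : 0 ≤ r := (norm_nonneg z).trans hzr.le
  have h : DifferentiableOn ℂ (fun z => ∑' n, b n * z ^ n) (Metric.ball 0 r) := by
    refine Complex.differentiableOn_tsum_of_summable_norm
      ((summable_geometric_of_lt_one hr0 hr).mul_left C) (fun n => ?_) Metric.isOpen_ball ?_
    · fun_prop
    · intro n w hw
      rw [norm_mul, norm_pow]
      have hw' : ‖w‖ ≤ r := (mem_ball_zero_iff.1 hw).le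
      have := (norm_nonneg _).trans (hb n)
      gcongr
      exact hb n
  exact (h.differentiableAt (Metric.isOpen_ball.mem_nhds (by simpa using hzr))).differentiableWithinAt

/-- A holomorphic function that is `O(1 / dist (z, 𝕋))` is `O(1 / r)` at the centre of a disc
of radius `r`, even if the disc crosses the unit circle. -/
lemma norm_mul_le_of_norm_mul_abs_sq_sub_one_le {F : ℂ → ℂ} {C : ℝ} (hC : 0 ≤ C) {c : ℂ} {r : ℝ}
    (hr : 0 < r) (hF : DifferentiableOn ℂ F (Metric.closedBall c r))
    (hb : ∀ z, ‖F z‖ * |‖z‖ ^ 2 - 1| ≤ C * (‖z‖ + 1)) :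
    ‖F c‖ * (‖c‖ * r) ≤ C * (‖c‖ + r + 1) := by
  -- On `‖w - c‖ = r` this polynomial equals `(w - c) * (‖w‖ ^ 2 - 1)`, so it cancels the blow-up of
  -- `F` at the unit circle, while `P c = c * r ^ 2`. The maximum principle for `P * F` then bounds
  -- `F c`.
  let P : ℂ → ℂ := fun w => (starRingEnd ℂ c) * (w - c) ^ 2
    + ((‖c‖ ^ 2 + r ^ 2 - 1 : ℝ) : ℂ) * (w - c) + c * (r : ℂ) ^ 2
  have hP : ∀ w, ‖w - c‖ = r → ‖P w‖ = r * |‖w‖ ^ 2 - 1| := by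
    intro w hw
    have hu : (w - c) * starRingEnd ℂ (w - c) = (r : ℂ) ^ 2 := by
      rw [Complex.mul_conj, Complex.normSq_eq_norm_sq, hw]; norm_cast
    have hc : c * starRingEnd ℂ c = ((‖c‖ ^ 2 : ℝ) : ℂ) := by
      rw [Complex.mul_conj, Complex.normSq_eq_norm_sq]
    have hww : w * starRingEnd ℂ w = ((‖w‖ ^ 2 : ℝ) : ℂ) := by
      rw [Complex.mul_conj, Complex.normSq_eq_norm_sq]
    have : P w = (w - c) * ((‖w‖ ^ 2 - 1 : ℝ) : ℂ) := by
      simp only [P]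
      push_cast at hc hww ⊢
      rw [← hww, ← hc, ← hu, map_sub]
      ring
    rw [this, norm_mul, hw, Complex.norm_real, Real.norm_eq_abs]
  have hmax : ‖P c * F c‖ ≤ r * (C * (‖c‖ + r + 1)) := by
    refine Complex.norm_le_of_forall_mem_frontier_norm_le (U := Metric.ball c r)
      (f := fun w => P w * F w) Metric.isBounded_ball ?_ ?_
      (subset_closure (Metric.mem_ball_self hr))
    · refine DifferentiableOn.diffContOnCl ?_
      rw [closure_ball c hr.ne']
      exact DifferentiableOn.mul (by simp only [P]; fun_prop) hF
    · intro w hw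
      rw [frontier_ball c hr.ne', mem_sphere_iff_norm] at hw
      rw [norm_mul, hP w hw, mul_assoc, mul_comm _ ‖F w‖]
      refine mul_le_mul_of_nonneg_left ((hb w).trans ?_) hr.le
      gcongr
      calc ‖w‖ = ‖c + (w - c)‖ := by ring_nf
        _ ≤ ‖c‖ + r := (norm_add_le _ _).trans (by rw [hw])
  have hPc : ‖P c‖ = ‖c‖ * r ^ 2 := by simp [P]
  rw [norm_mul, hPc] at hmax
  refine le_of_mul_le_mul_left ?_ hr
  linarith

/-- A function holomorphic off `1` that is `O(1 / dist (z, 𝕋))` is a multiple of `1 / (z - 1)`. -/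
lemma exists_forall_sub_one_mul_eq {F : ℂ → ℂ} {C : ℝ} (hF : DifferentiableOn ℂ F {1}ᶜ)
    (hb : ∀ z, ‖F z‖ * |‖z‖ - 1| ≤ C) : ∃ c, ∀ z, z ≠ 1 → (z - 1) * F z = c := by
  have hC : 0 ≤ C := le_trans (by positivity) (hb 0)
  have hb2 : ∀ z, ‖F z‖ * |‖z‖ ^ 2 - 1| ≤ C * (‖z‖ + 1) := by
    intro z
    have : |‖z‖ ^ 2 - 1| = |‖z‖ - 1| * (‖z‖ + 1) := by
      rw [show ‖z‖ ^ 2 - 1 = (‖z‖ - 1) * (‖z‖ + 1) by ring, abs_mul,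
        abs_of_nonneg (show 0 ≤ ‖z‖ + 1 by positivity)]
    rw [this, ← mul_assoc]
    gcongr
    exact hb z
  -- `H` is bounded near `1`, by the previous lemma on the disc of radius `‖z - 1‖ / 2`, and near
  -- infinity; removing the singularity and applying Liouville makes it constant.
  let H : ℂ → ℂ := fun z => (z - 1) * F z
  have hH : DifferentiableOn ℂ H {1}ᶜ := DifferentiableOn.mul (by fun_prop) hF
  have hnear : ∀ z ∈ Metric.ball (1 : ℂ) (1 / 2) \ {1}, ‖H z‖ ≤ 12 * C := by
    rintro z ⟨hz, hz1⟩
    have hz1 : z ≠ 1 := hz1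
    rw [mem_ball_iff_norm] at hz
    have hd : 0 < ‖z - 1‖ := norm_pos_iff.2 (sub_ne_zero.2 hz1)
    have hlow : 1 / 2 ≤ ‖z‖ := by
      have := norm_sub_norm_le (1 : ℂ) z
      rw [norm_sub_rev, norm_one] at this
      linarith
    have hup : ‖z‖ ≤ 3 / 2 := by
      have := norm_sub_norm_le z (1 : ℂ)
      rw [norm_one] at this
      linarith
    have key := norm_mul_le_of_norm_mul_abs_sq_sub_one_le hC (c := z) (half_pos hd)
      (hF.mono fun w hw h1 => by
        rw [Set.mem_singleton_iff.1 h1, mem_closedBall_iff_norm, norm_sub_rev] at hw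
        linarith) hb2
    have h1 : ‖F z‖ * ((1 / 2) * (‖z - 1‖ / 2)) ≤ ‖F z‖ * (‖z‖ * (‖z - 1‖ / 2)) := by gcongr
    have h2 : C * (‖z‖ + ‖z - 1‖ / 2 + 1) ≤ C * 3 := by gcongr; linarith
    simp only [H, norm_mul]
    linarith
  have hfar : ∀ z, 2 ≤ ‖z‖ → ‖H z‖ ≤ 3 * C := by
    intro z hz
    have h1 := hb z
    rw [abs_of_nonneg (by linarith)] at h1
    have h2 : ‖z - 1‖ ≤ 3 * (‖z‖ - 1) := by
      have := norm_sub_le z 1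
      rw [norm_one] at this
      linarith
    calc ‖H z‖ = ‖z - 1‖ * ‖F z‖ := norm_mul _ _
      _ ≤ 3 * (‖z‖ - 1) * ‖F z‖ := by gcongr
      _ ≤ 3 * C := by linarith
  let G : ℂ → ℂ := Function.update H 1 (Filter.limUnder (nhdsWithin 1 {1}ᶜ) H)
  have hG : Differentiable ℂ G := by
    intro z
    by_cases hz : z = 1
    · have hm : Metric.ball (1 : ℂ) (1 / 2) ∈ nhds 1 := Metric.ball_mem_nhds _ (by norm_num)
      rw [hz]
      refine (Complex.differentiableOn_update_limUnder_of_bddAbove hm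
        (hH.mono fun w hw => hw.2) ⟨12 * C, ?_⟩).differentiableAt hm
      rintro _ ⟨w, hw, rfl⟩
      exact hnear w hw
    · have hm : ({1}ᶜ : Set ℂ) ∈ nhds z := isOpen_compl_singleton.mem_nhds hz
      refine (hH.differentiableAt hm).congr_of_eventuallyEq ?_
      filter_upwards [hm] with w hw using Function.update_of_ne hw _ _
  have hGH : ∀ z, z ≠ 1 → G z = H z := fun z hz => Function.update_of_ne hz _ _
  have hbdd : Bornology.IsBounded (Set.range G) := by
    have hcpt := ((isCompact_closedBall (0 : ℂ) 2).image hG.continuous).isBounded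
    refine (hcpt.union (Metric.isBounded_closedBall (x := (0 : ℂ)) (r := 3 * C))).subset ?_
    rintro _ ⟨z, rfl⟩
    rcases le_total ‖z‖ 2 with h | h
    · exact Or.inl ⟨z, by simpa using h, rfl⟩
    · refine Or.inr ?_
      rw [mem_closedBall_zero_iff, hGH z (by rintro rfl; norm_num at h)]
      exact hfar z h
  exact ⟨G 0, fun z hz => by rw [← hG.apply_eq_apply_of_bounded hbdd z 0, hGH z hz]⟩

/-- If the Carleman transform of a bounded two-sided sequence extends holomorphically across
`𝕋 \ {1}`, the entries with indices `0` and `-1` agree. -/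
lemma apply_zero_eq_of_carleman {b d : ℕ → ℂ} {C : ℝ} (hb : ∀ n, ‖b n‖ ≤ C) (hd : ∀ n, ‖d n‖ ≤ C)
    {V : Set ℂ} (hV : IsOpen V) (hVs : Metric.sphere (0 : ℂ) 1 \ {1} ⊆ V) {f : ℂ → ℂ}
    (hf : DifferentiableOn ℂ f V)
    (hin : ∀ z ∈ V, ‖z‖ < 1 → f z = -∑' n, d n * z ^ n)
    (hout : ∀ z ∈ V, 1 < ‖z‖ → f z = z⁻¹ * ∑' n, b n * z⁻¹ ^ n) : b 0 = d 0 := by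
  classical
  -- Off the circle the series alone define `F`, so `V` may miss points there; `f` is needed only to
  -- glue across the circle.
  let F : ℂ → ℂ := fun z => if ‖z‖ < 1 then -∑' n, d n * z ^ n
    else if 1 < ‖z‖ then z⁻¹ * ∑' n, b n * z⁻¹ ^ n else if z ∈ V then f z else 0
  have Fin : ∀ z, ‖z‖ < 1 → F z = -∑' n, d n * z ^ n := fun z hz => if_pos hz
  have Fout : ∀ z, 1 < ‖z‖ → F z = z⁻¹ * ∑' n, b n * z⁻¹ ^ n := fun z hz => by
    simp only [F]; rw [if_neg hz.le.not_gt, if_pos hz]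
  have FV : ∀ z ∈ V, F z = f z := by
    intro z hz
    rcases lt_trichotomy ‖z‖ 1 with h | h | h
    · rw [Fin z h, hin z hz h]
    · simp [F, h, hz]
    · rw [Fout z h, hout z hz h]
  have hinv : ∀ {z : ℂ}, 1 < ‖z‖ → ‖z⁻¹‖ < 1 := fun h => by
    rw [norm_inv]; exact inv_lt_one_of_one_lt₀ h
  have hF : DifferentiableOn ℂ F {1}ᶜ := by
    intro z hz
    refine DifferentiableAt.differentiableWithinAt ?_
    rcases lt_trichotomy ‖z‖ 1 with h | h | h
    · have hm : Metric.ball (0 : ℂ) 1 ∈ nhds z := Metric.isOpen_ball.mem_nhds (by simpa using h)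
      refine ((differentiableOn_tsum_mul_pow hd).differentiableAt hm).neg.congr_of_eventuallyEq ?_
      filter_upwards [hm] with w hw using Fin w (by simpa using hw)
    · have hm : V ∈ nhds z := hV.mem_nhds (hVs ⟨by simpa using h, hz⟩)
      refine (hf.differentiableAt hm).congr_of_eventuallyEq ?_
      filter_upwards [hm] with w hw using FV w hw
    · have hz0 : z ≠ 0 := by rintro rfl; norm_num at h
      have hm : Metric.ball (0 : ℂ) 1 ∈ nhds z⁻¹ :=
        Metric.isOpen_ball.mem_nhds (by simpa using hinv h)
      have hi := differentiableAt_inv (𝕜 := ℂ) hz0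
      refine (hi.mul (((differentiableOn_tsum_mul_pow hb).differentiableAt hm).comp z
        hi)).congr_of_eventuallyEq ?_
      filter_upwards [(isOpen_lt continuous_const continuous_norm).mem_nhds h] with w hw
        using Fout w hw
  have hbF : ∀ z, ‖F z‖ * |‖z‖ - 1| ≤ C := by
    intro z
    rcases lt_trichotomy ‖z‖ 1 with h | h | h
    · rw [abs_sub_comm, abs_of_pos (by linarith), Fin z h, norm_neg]
      have := norm_tsum_mul_pow_le hd h
      rwa [← div_eq_mul_inv, le_div_iff₀ (by linarith)] at this
    · simpa [h] using (norm_nonneg _).trans (hb 0)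
    · rw [abs_of_pos (by linarith), Fout z h, norm_mul]
      have := norm_tsum_mul_pow_le hb (hinv h)
      have hp : 0 < 1 - ‖z⁻¹‖ := by linarith [hinv h]
      rw [← div_eq_mul_inv, le_div_iff₀ hp] at this
      calc _ = ‖∑' n, b n * z⁻¹ ^ n‖ * (1 - ‖z⁻¹‖) := by
            rw [norm_inv]; field_simp
        _ ≤ C := this
  obtain ⟨c, hc⟩ := exists_forall_sub_one_mul_eq hF hbF
  have hd0 : d 0 = c := by
    rw [← hc 0 zero_ne_one, Fin 0 (by simp), tsum_eq_single 0 (by simp +contextual)]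
    simp
  -- `b 0` is read off at infinity: with `w = z⁻¹`, `(z - 1) * F z = c` becomes `(1 - w) * ∑' n, b n
  -- * w ^ n = c`; let `w → 0`.
  have hb0 : b 0 = c := by
    have hcont : Filter.Tendsto (fun w : ℂ => ∑' n, b n * w ^ n) (nhdsWithin 0 {0}ᶜ)
        (nhds (b 0)) := by
      have := ((differentiableOn_tsum_mul_pow hb).differentiableAt
        (Metric.ball_mem_nhds (0 : ℂ) one_pos)).continuousAt.tendsto
      rw [tsum_eq_single 0 (by simp +contextual)] at this
      simpa using this.mono_left nhdsWithin_le_nhds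
    have hlim : Filter.Tendsto (fun w : ℂ => c / (1 - w)) (nhdsWithin 0 {0}ᶜ) (nhds c) := by
      have : ContinuousAt (fun w : ℂ => c / (1 - w)) 0 :=
        continuousAt_const.div (by fun_prop) (by simp)
      simpa using this.tendsto.mono_left nhdsWithin_le_nhds
    refine tendsto_nhds_unique (hcont.congr' ?_) hlim
    filter_upwards [self_mem_nhdsWithin,
      nhdsWithin_le_nhds (Metric.ball_mem_nhds (0 : ℂ) one_pos)] with w hw0 hw
    have hw0 : w ≠ 0 := hw0
    have hw : ‖w‖ < 1 := by simpa using hw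
    have h1 : 1 - w ≠ 0 := by
      intro h
      rw [← sub_eq_zero.1 h, norm_one] at hw
      exact lt_irrefl _ hw
    have hwi : 1 < ‖w⁻¹‖ := by
      rw [norm_inv]; exact (one_lt_inv₀ (norm_pos_iff.2 hw0)).2 hw
    have := hc w⁻¹ (by rintro h; rw [h, norm_one] at hwi; exact lt_irrefl _ hwi)
    rw [Fout _ hwi, inv_inv] at this
    rw [eq_div_iff h1, ← this]
    field_simp
  rw [hb0, hd0]

/-! ### Limit functionals of asymptotic orbits -/

/-- The sum telescopes. It identifies both halves of the Carleman transform with the resolvent. -/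
lemma tsum_sub_mul_mul_pow {g : ℕ → ℂ} {K : ℝ} (hg : ∀ n, ‖g n‖ ≤ K) {w : ℂ} (hw : ‖w‖ < 1) :
    ∑' n, (g n - w * g (n + 1)) * w ^ n = g 0 := by
  have hs : Summable fun n => g n * w ^ n := by
    refine Summable.of_norm_bounded
      ((summable_geometric_of_lt_one (norm_nonneg w) hw).mul_left K) fun n => ?_
    rw [norm_mul, norm_pow]
    gcongr
    exact hg n
  have hs' := (summable_nat_add_iff 1).2 hs
  calc ∑' n, (g n - w * g (n + 1)) * w ^ n
      = ∑' n, (g n * w ^ n - g (n + 1) * w ^ (n + 1)) := tsum_congr fun n => by ring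
    _ = g 0 := by
        rw [hs.tsum_sub hs', hs.tsum_eq_zero_add]
        simp

/-- Banach–Alaoglu: the closed ball of the dual is weak-* compact. -/
lemma exists_ultrafilter_limit {ι E : Type*} [NormedAddCommGroup E] [NormedSpace ℂ E]
    (U : Ultrafilter ι) {C : ℝ} (ψ : ι → StrongDual ℂ E) (hψ : ∀ i, ‖ψ i‖ ≤ C) :
    ∃ Λ : StrongDual ℂ E, ‖Λ‖ ≤ C ∧
      ∀ x, Filter.Tendsto (fun i => ψ i x) U (nhds (Λ x)) := by
  obtain ⟨Λ, hΛ, hlim⟩ := (WeakDual.isCompact_closedBall (0 : StrongDual ℂ E) C).ultrafilter_le_nhds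
    (U.map fun i => StrongDual.toWeakDual (ψ i)) (by
      rw [Filter.le_principal_iff, Ultrafilter.coe_map, Filter.mem_map]
      exact Filter.univ_mem' fun i => by simpa using hψ i)
  refine ⟨WeakDual.toStrongDual Λ, by simpa using hΛ, fun x => ?_⟩
  exact ((WeakDual.eval_continuous x).tendsto Λ).comp hlim

/-- A Katznelson–Tzafriri theorem for bounded sequences in a Banach algebra that are
asymptotically orbits of left multiplication by `T`. -/
theorem tendsto_norm_succ_sub_of_asymptotic_orbit {A : Type*} [NormedRing A] [NormedAlgebra ℂ A]
    [CompleteSpace A] {T : A} (hσ : spectrum ℂ T ∩ Metric.sphere (0 : ℂ) 1 ⊆ {1})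
    {M : ℕ → A} {C : ℝ} (hM : ∀ n, ‖M n‖ ≤ C)
    (hT : Filter.Tendsto (fun n => T * M n - M (n + 1)) Filter.atTop (nhds 0)) :
    Filter.Tendsto (fun n => ‖M (n + 1) - M n‖) Filter.atTop (nhds 0) := by
  by_contra hcon
  obtain ⟨ε, hε, hfreq⟩ : ∃ ε > 0, ∃ᶠ n in Filter.atTop, ε ≤ ‖M (n + 1) - M n‖ := by
    rw [Metric.tendsto_nhds] at hcon
    push Not at hcon
    simpa using hcon
  have hne : (Filter.atTop ⊓ Filter.principal {n | ε ≤ ‖M (n + 1) - M n‖}).NeBot :=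
    Filter.frequently_mem_iff_neBot.1 hfreq
  let U : Ultrafilter ℕ := Ultrafilter.of (Filter.atTop ⊓ Filter.principal
    {n | ε ≤ ‖M (n + 1) - M n‖})
  have hU : (U : Filter ℕ) ≤ Filter.atTop := (Ultrafilter.of_le _).trans inf_le_left
  have hUε : ∀ᶠ n in (U : Filter ℕ), ε ≤ ‖M (n + 1) - M n‖ :=
    (Ultrafilter.of_le _).trans inf_le_right (Filter.mem_principal_self _)
  choose φ hφ hφM using fun n => exists_dual_vector'' ℂ (M (n + 1) - M n)
  -- The shift by `1` makes `m = 0` and `m = -1` correspond to `M (n + 1)` and `M n`. For fixed `m`,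
  -- `toNat` truncates only finitely many `n`, which the limit ignores.
  let idx : ℤ → ℕ → ℕ := fun m n => (m + 1 + n).toNat
  let ψ : ℤ → ℕ → StrongDual ℂ A := fun m n =>
    (φ n).comp ((ContinuousLinearMap.mul ℂ A).flip (M (idx m n)))
  have hψ_apply : ∀ m n B, ψ m n B = φ n (B * M (idx m n)) := fun m n B => rfl
  have hC : 0 ≤ C := (norm_nonneg _).trans (hM 0)
  have hψ : ∀ m n, ‖ψ m n‖ ≤ C := by
    refine fun m n => ContinuousLinearMap.opNorm_le_bound _ hC fun B => ?_
    calc ‖ψ m n B‖ ≤ ‖φ n‖ * ‖B * M (idx m n)‖ := (φ n).le_opNorm _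
      _ ≤ 1 * (‖B‖ * C) := by
        gcongr
        · exact hφ n
        · exact (norm_mul_le _ _).trans (by gcongr; exact hM _)
      _ = C * ‖B‖ := by ring
  choose Λ hΛ hlim using fun m => exists_ultrafilter_limit U (ψ m) (hψ m)
  have hshift : ∀ m B, Λ m (B * T) = Λ (m + 1) B := by
    intro m B
    refine sub_eq_zero.1 (tendsto_nhds_unique ((hlim m (B * T)).sub (hlim (m + 1) B)) ?_)
    have hidx : Filter.Tendsto (idx m) U Filter.atTop := by
      refine Filter.Tendsto.mono_left ?_ hU
      refine Filter.tendsto_atTop.2 fun k => ?_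
      filter_upwards [Filter.eventually_ge_atTop (k + (m + 1).natAbs)] with n hn
      simp only [idx]
      omega
    have h0 : Filter.Tendsto (fun n => ‖B‖ * ‖T * M (idx m n) - M (idx m n + 1)‖) U (nhds 0) := by
      simpa using (hT.comp hidx).norm.const_mul ‖B‖
    refine squeeze_zero_norm' ?_ h0
    filter_upwards [hU (Filter.eventually_ge_atTop (m + 1).natAbs)] with n hn
    have hs : idx (m + 1) n = idx m n + 1 := by
      simp only [idx] at hn ⊢
      omega
    rw [hψ_apply, hψ_apply, hs, ← map_sub, mul_assoc, ← mul_sub]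
    calc _ ≤ ‖φ n‖ * ‖B * (T * M (idx m n) - M (idx m n + 1))‖ := (φ n).le_opNorm _
      _ ≤ 1 * (‖B‖ * ‖T * M (idx m n) - M (idx m n + 1)‖) := by
        gcongr
        · exact hφ n
        · exact norm_mul_le _ _
      _ = _ := one_mul _
  -- Apply `Λ m` to `resolvent T z * (z - T) = 1`, turning right multiplication by `T` into a shift.
  have hrec : ∀ z ∈ resolventSet ℂ T, ∀ m,
      Λ m 1 = z * Λ m (resolvent T z) - Λ (m + 1) (resolvent T z) := by
    intro z hz m
    rw [← hshift, ← smul_eq_mul, ← map_smul, ← map_sub]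
    congr 1
    have h : resolvent T z * (algebraMap ℂ A z - T) = 1 := Ring.inverse_mul_cancel _ hz
    rw [← h, mul_sub, ← Algebra.commutes, Algebra.smul_def]
  have hbound : ∀ m B, ‖Λ m B‖ ≤ C * ‖B‖ := fun m B =>
    ((Λ m).le_opNorm B).trans (by gcongr; exact hΛ m)
  have heq : Λ (0 : ℕ) 1 = Λ (-(0 : ℕ) - 1) 1 := by
    refine apply_zero_eq_of_carleman (b := fun k : ℕ => Λ k 1) (d := fun k : ℕ => Λ (-k - 1) 1)
      (fun k => hbound _ _) (fun k => hbound _ _) (V := resolventSet ℂ T)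
      (f := fun z => Λ 0 (resolvent T z)) (spectrum.isOpen_resolventSet T) ?_ ?_ ?_ ?_
    · rintro z ⟨hz, hz1⟩
      by_contra h
      exact hz1 (hσ ⟨h, hz⟩)
    · exact fun z hz => ((Λ 0).differentiableAt.comp z
        (spectrum.hasDerivAt_resolvent_const_left hz).differentiableAt).differentiableWithinAt
    · intro z hz h
      have key := tsum_sub_mul_mul_pow (g := fun k : ℕ => Λ (-k) (resolvent T z))
        (fun k => hbound _ _) h
      simp only [Nat.cast_zero, neg_zero] at key
      rw [← tsum_neg, ← key]
      refine tsum_congr fun k => ?_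
      rw [hrec z hz, show -(k : ℤ) - 1 + 1 = -k by ring,
        show -((k + 1 : ℕ) : ℤ) = -k - 1 by push_cast; ring]
      ring
    · intro z hz h
      have hz0 : z ≠ 0 := by rintro rfl; norm_num at h
      have hi : ‖z⁻¹‖ < 1 := by rw [norm_inv]; exact inv_lt_one_of_one_lt₀ h
      have key := tsum_sub_mul_mul_pow (g := fun k : ℕ => Λ k (resolvent T z))
        (fun k => hbound _ _) hi
      simp only [Nat.cast_zero] at key
      rw [← tsum_mul_left, ← key]
      refine tsum_congr fun k => ?_
      rw [hrec z hz]
      push_cast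
      field_simp
  have hdiff : Filter.Tendsto (fun n => φ n (M (n + 1) - M n)) U (nhds 0) := by
    have := (hlim (0 : ℕ) 1).sub (hlim (-(0 : ℕ) - 1) 1)
    rw [heq, sub_self] at this
    refine this.congr fun n => ?_
    have h1 : idx (0 : ℕ) n = n + 1 := by simp only [idx]; omega
    have h2 : idx (-(0 : ℕ) - 1) n = n := by simp only [idx]; omega
    rw [hψ_apply, hψ_apply, h1, h2, one_mul, one_mul, map_sub]
  have hle : ε ≤ 0 := by
    rw [← norm_zero (E := ℂ)]
    refine ge_of_tendsto hdiff.norm (hUε.mono fun n hn => ?_)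
    rwa [hφM, RCLike.norm_ofReal, abs_norm]
  exact hε.not_ge hle

/-! ### Cesàro kernels and means -/

lemma cesaroKernel_pos {β : ℝ} (hβ : 0 < β) (n : ℕ) : 0 < cesaroKernel β n :=
  div_pos (Real.Gamma_pos_of_pos (by positivity))
    (mul_pos (Real.Gamma_pos_of_pos hβ) (Real.Gamma_pos_of_pos (by positivity)))

lemma cesaroKernel_succ {β : ℝ} (hβ : 0 < β) (n : ℕ) :
    cesaroKernel β (n + 1) = (β + n) / (n + 1) * cesaroKernel β n := by
  have h1 : Real.Gamma (β + (n + 1 : ℕ)) = (β + n) * Real.Gamma (β + n) := by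
    rw [← Real.Gamma_add_one (by positivity)]; push_cast; ring_nf
  have h2 : Real.Gamma ((n + 1 : ℕ) + 1) = (n + 1) * Real.Gamma (n + 1) := by
    rw [Real.Gamma_add_one (by positivity)]; push_cast; rfl
  rw [cesaroKernel, cesaroKernel, h1, h2, div_mul_div_comm, mul_left_comm]

lemma cesaroKernel_order_succ {β : ℝ} (hβ : 0 < β) (n : ℕ) :
    cesaroKernel (β + 1) n = (β + n) / β * cesaroKernel β n := by
  have h1 : Real.Gamma (β + 1 + n) = (β + n) * Real.Gamma (β + n) := by
    rw [← Real.Gamma_add_one (by positivity)]; ring_nf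
  rw [cesaroKernel, cesaroKernel, h1, Real.Gamma_add_one hβ.ne', div_mul_div_comm, mul_assoc]

section

variable {X : Type*} [NormedAddCommGroup X] [NormedSpace ℂ X]

lemma cesaroSum_succ (α : ℝ) (T : X →L[ℂ] X) (n : ℕ) :
    cesaroSum α T (n + 1) = T * cesaroSum α T n + ((cesaroKernel α (n + 1) : ℝ) : ℂ) • 1 := by
  rw [cesaroSum, Finset.sum_range_succ', cesaroSum, Finset.mul_sum]
  congr 1
  refine Finset.sum_congr rfl fun j _ => ?_
  rw [Nat.add_sub_add_right, mul_smul_comm, pow_succ']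

/-- Normalising the recursion for the Cesàro sums makes `M (n + 1)` a convex combination of `T * M
n` and `1`, with weight `α / (α + n + 1)` on `1`. -/
lemma mul_cesaroMean_sub_succ {α : ℝ} (hα : 0 < α) (T : X →L[ℂ] X) (n : ℕ) :
    T * cesaroMean α T n - cesaroMean α T (n + 1)
      = ((α / (α + (n + 1 : ℕ)) : ℝ) : ℂ) • (T * cesaroMean α T n - 1) := by
  have hk := (cesaroKernel_pos (add_pos hα one_pos) n).ne'
  have hk0 := (cesaroKernel_pos hα (n + 1)).ne'
  have hn : (0 : ℝ) < α + (n + 1 : ℕ) := by positivity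
  have h1 : 1 / cesaroKernel (α + 1) (n + 1)
      = (1 - α / (α + (n + 1 : ℕ))) * (1 / cesaroKernel (α + 1) n) := by
    rw [cesaroKernel_succ (add_pos hα one_pos)]
    push_cast at hn ⊢
    have : α + 1 + (n : ℝ) ≠ 0 := by linarith
    field_simp
    ring
  have h2 : 1 / cesaroKernel (α + 1) (n + 1) * cesaroKernel α (n + 1)
      = α / (α + (n + 1 : ℕ)) := by
    rw [cesaroKernel_order_succ hα]
    field_simp
  have h3 : cesaroMean α T (n + 1) = ((1 - α / (α + (n + 1 : ℕ)) : ℝ) : ℂ) • (T * cesaroMean α T n)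
      + ((α / (α + (n + 1 : ℕ)) : ℝ) : ℂ) • 1 := by
    rw [cesaroMean, cesaroSum_succ, smul_add, smul_smul, ← Complex.ofReal_mul, h2, h1,
      Complex.ofReal_mul, mul_smul, cesaroMean, mul_smul_comm]
  rw [h3, Complex.ofReal_sub, Complex.ofReal_one, sub_smul, one_smul, smul_sub]
  abel

end

theorem mainTheorem3 {X : Type*} [NormedAddCommGroup X] [NormedSpace ℂ X] [CompleteSpace X]
    (α : ℝ) (hα : 0 < α) (T : X →L[ℂ] X) (hT : IsCesaroBounded α T)
    (hσ : spectrum ℂ T ∩ Metric.sphere (0 : ℂ) 1 ⊆ {1}) :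
    Filter.Tendsto (fun n : ℕ => ‖cesaroMean α T (n + 1) - cesaroMean α T n‖)
      Filter.atTop (nhds 0) := by
  obtain ⟨C, hC⟩ := hT
  have hM : ∀ n, ‖cesaroMean α T n‖ ≤ C := fun n => hC ⟨n, rfl⟩
  refine tendsto_norm_succ_sub_of_asymptotic_orbit hσ hM ?_
  have hlim : Filter.Tendsto (fun n : ℕ => α / (α + (n + 1 : ℕ)) * (‖T‖ * C + ‖(1 : X →L[ℂ] X)‖))
      Filter.atTop (nhds 0) := by
    have h : Filter.Tendsto (fun n : ℕ => α + ((n + 1 : ℕ) : ℝ)) Filter.atTop Filter.atTop :=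
      Filter.tendsto_atTop_add_const_left _ _
        (tendsto_natCast_atTop_atTop.comp (Filter.tendsto_add_atTop_nat 1))
    simpa using (h.const_div_atTop α).mul_const (‖T‖ * C + ‖(1 : X →L[ℂ] X)‖)
  refine squeeze_zero_norm (fun n => ?_) hlim
  rw [mul_cesaroMean_sub_succ hα, norm_smul, Complex.norm_real, Real.norm_of_nonneg (by positivity)]
  gcongr
  refine (norm_sub_le _ _).trans ?_
  gcongr
  refine (norm_mul_le _ _).trans ?_
  gcongr
  exact hM n
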